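/- Let $H$ be a complex Hilbert space. A linear operator $S$ in $H$ is *symmetric* if it is densely defined and $(Sf,g)=(f,Sg)$ for all $f,g\in\operatorname{dom}(S)$. Products of operators have their natural domains, e.g. $\operatorname{dom}(S^2)=\{f\in\operatorname{dom}(S): Sf\in\operatorname{dom}(S)\}$. The *Friedrichs extension* $T_F$ of a nonnegative symmetric operator $T$ is the nonnegative self-adjoint operator associated with the closure of the form $q(f,g)=(f,Tg)$, $f,g\in\operatorname{dom}(T)$. A subspace $D\subseteq\operatorname{dom}(S)$ is a *core* for the closable operator $S$ if $\overline{S|_D}=\overline S$. The *deficiency indices* of $\overline S$ are the dimensions of $\operatorname{ran}(\overline S\pm i)^{\perp}$. **Theorem 3.1.** Let $S$ be symmetric in $H$ with $\operatorname{dom}(S^2)$ dense in $H$ (so that $S^2$ is symmetric and nonnegative). (i) Put $R:=\overline{S|_{\operatorname{dom}(S^2)}}$. Then $(S^2)_F=R^*R$; in particular $R^*R$ is a nonnegative self-adjoint extension of $S^2$. Moreover $S^*\overline S=(\overline S)^*\overline S$, and $(S^2)_F=S^*\overline S$ if and only if $\operatorname{dom}(S^2)$ is a core for $S$. In general $(S^2)_F$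 differs from $S^*\overline S$: there are a complex Hilbert space and a closed symmetric operator $S$ in it such that $\operatorname{dom}(S^2)$ is dense but not a core for $S$, and hence $(S^2)_F\neq S^*\overline S$. (ii) Suppose that at least one of the deficiency indices of $\overline S$ is finite. Then $\operatorname{dom}(\overline S^{\,2})$ is dense and a core for $\overline S$, and $(\overline S^{\,2})_F=S^*\overline S$. In particular, if $S$ is closed, then $(S^2)_F=S^*\overline S$, and $\operatorname{dom}(S^2)$ is a core for $S$. -/

import Mathlib

open Filter Topology

namespace FriedrichsSquare

variable {H : Type*} [NormedAddCommGroup H] [InnerProductSpace ℂ H]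

/-- A symmetric operator: densely defined, with `(T f, g) = (f, T g)` for all `f, g ∈ dom T`. -/
structure IsSymmetric (T : H →ₗ.[ℂ] H) : Prop where
  dense : Dense (T.domain : Set H)
  inner_eq : ∀ f g : T.domain, inner ℂ (T f) (g : H) = inner ℂ (f : H) (T g)

/-- `T ≥ 0`: `(f, T f) ≥ 0` for all `f ∈ dom T`. -/
def IsNonneg (T : H →ₗ.[ℂ] H) : Prop :=
  ∀ f : T.domain, 0 ≤ (inner ℂ (f : H) (T f)).re ∧ (inner ℂ (f : H) (T f)).im = 0

/-- The product `A B` of unbounded operators on its natural domain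
`dom (A B) = {f ∈ dom B | B f ∈ dom A}`. -/
def opMul (A B : H →ₗ.[ℂ] H) : H →ₗ.[ℂ] H where
  domain := (A.domain.comap B.toFun).map B.domain.subtype
  toFun :=
    { toFun := fun f => A ⟨B ⟨f, by
          obtain ⟨x, _, hx⟩ := f.2
          rw [← hx]; exact x.2⟩, by
          obtain ⟨x, hx, hxf⟩ := f.2
          have h : x = ⟨(f : H), by rw [← hxf]; exact x.2⟩ := Subtype.ext hxf
          rw [h] at hx
          exact hx⟩
      map_add' := fun f g => by
        rw [← LinearPMap.map_add]
        congr 1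
        apply Subtype.ext
        exact LinearPMap.map_add B ⟨f, _⟩ ⟨g, _⟩
      map_smul' := fun c f => by
        rw [RingHom.id_apply, ← LinearPMap.map_smul]
        congr 1
        apply Subtype.ext
        exact LinearPMap.map_smul B c ⟨f, _⟩ }

theorem mem_opMul_graph (A B : H →ₗ.[ℂ] H) (f h : H) :
    (f, h) ∈ (opMul A B).graph ↔ ∃ g, (f, g) ∈ B.graph ∧ (g, h) ∈ A.graph := by
  simp only [LinearPMap.mem_graph_iff]
  constructor
  · rintro ⟨⟨y, hy⟩, rfl, rfl⟩
    obtain ⟨x, hx, rfl⟩ := hy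
    exact ⟨B x, ⟨x, rfl, rfl⟩, ⟨B x, hx⟩, rfl, rfl⟩
  · rintro ⟨g, ⟨x, rfl, rfl⟩, ⟨y, hy, rfl⟩⟩
    refine ⟨⟨x, ⟨x, ?_, rfl⟩⟩, rfl, ?_⟩
    · change B x ∈ A.domain
      exact hy ▸ y.2
    · change A ⟨B x, _⟩ = A y
      congr 1
      exact Subtype.ext hy.symm

/-- `S²` on its natural domain `{f ∈ dom S | S f ∈ dom S}`. -/
def opSq (S : H →ₗ.[ℂ] H) : H →ₗ.[ℂ] H := opMul S S

/-- `D` is a core for the closable operator `T`: `D ⊆ dom T`, and the restriction of `T` to `D`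
has the same closure as `T`. (`T` itself need not be closed.) -/
def IsCore (T : H →ₗ.[ℂ] H) (D : Submodule ℂ H) : Prop :=
  D ≤ T.domain ∧ (T.domRestrict D).closure = T.closure

/-- The defect subspace `(ran (T - z))ᗮ`. The two deficiency indices of a closed symmetric
operator `T` are the dimensions of its defect subspaces at `z = -i` and at `z = i`. -/
noncomputable def defectSubspace (T : H →ₗ.[ℂ] H) (z : ℂ) : Submodule ℂ H :=
  (LinearMap.range (T.toFun - z • T.domain.subtype))ᗮ

/-- At least one of the two deficiency indices of `T` is finite. -/
def HasFiniteDeficiencyIndex (T : H →ₗ.[ℂ] H) : Prop :=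
  FiniteDimensional ℂ (defectSubspace T (-Complex.I)) ∨
    FiniteDimensional ℂ (defectSubspace T Complex.I)

section Form

variable (T : H →ₗ.[ℂ] H)

/-- The form `q(f, g) = (f, T g)` on `dom T`. -/
noncomputable def form (f g : T.domain) : ℂ := inner ℂ (f : H) (T g)

/-- The sequence `u` in `dom T` is form-convergent to `f`: `u n → f` in `H`, and
`q(u n - u m, u n - u m) → 0` as `n, m → ∞`. -/
def FormTendsto (u : ℕ → T.domain) (f : H) : Prop :=
  Tendsto (fun n => (u n : H)) atTop (𝓝 f) ∧
    Tendsto (fun p : ℕ × ℕ => form T (u p.1 - u p.2) (u p.1 - u p.2)) atTop (𝓝 0)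

variable {T}

theorem form_add_left (f g h : T.domain) : form T (f + g) h = form T f h + form T g h := by
  simp [form]

theorem form_add_right (f g h : T.domain) : form T f (g + h) = form T f g + form T f h := by
  simp [form, LinearPMap.map_add]

theorem form_neg_left (f g : T.domain) : form T (-f) g = -form T f g := by
  simp [form]

theorem form_neg_right (f g : T.domain) : form T f (-g) = -form T f g := by
  simp [form, LinearPMap.map_neg]

theorem form_smul (c d : ℂ) (f g : T.domain) :
    form T (c • f) (d • g) = (starRingEnd ℂ c * d) * form T f g := by
  simp [form, LinearPMap.map_smul]
  ring

theorem norm_form_self (hT : IsNonneg T) (f : T.domain) : ‖form T f f‖ = (form T f f).re := by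
  obtain ⟨h1, h2⟩ := hT f
  have : form T f f = ((form T f f).re : ℂ) := by
    apply Complex.ext
    · simp
    · simpa [form] using h2
  conv_lhs => rw [this]
  rw [Complex.norm_real]
  exact Real.norm_of_nonneg h1

theorem norm_form_add_le (hT : IsNonneg T) (f g : T.domain) :
    ‖form T (f + g) (f + g)‖ ≤ 2 * ‖form T f f‖ + 2 * ‖form T g g‖ := by
  have h := (hT (f - g)).1
  change 0 ≤ (form T (f - g) (f - g)).re at h
  rw [norm_form_self hT, norm_form_self hT, norm_form_self hT]
  rw [sub_eq_add_neg] at h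
  simp only [form_add_left, form_add_right, form_neg_left, form_neg_right, Complex.add_re,
    Complex.neg_re] at h ⊢
  linarith

theorem FormTendsto.add (hT : IsNonneg T) {u v : ℕ → T.domain} {f g : H}
    (hu : FormTendsto T u f) (hv : FormTendsto T v g) :
    FormTendsto T (fun n => u n + v n) (f + g) := by
  refine ⟨by simpa using hu.1.add hv.1, ?_⟩
  have h := (hu.2.norm.const_mul 2).add (hv.2.norm.const_mul 2)
  simp only [norm_zero, mul_zero, add_zero] at h
  refine squeeze_zero_norm (fun p => ?_) h
  rw [add_sub_add_comm]
  exact norm_form_add_le hT _ _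

theorem FormTendsto.smul {u : ℕ → T.domain} {f : H} (c : ℂ) (hu : FormTendsto T u f) :
    FormTendsto T (fun n => c • u n) (c • f) := by
  refine ⟨by simpa using hu.1.const_smul c, ?_⟩
  have h := hu.2.const_mul (starRingEnd ℂ c * c)
  rw [mul_zero] at h
  refine h.congr fun p => ?_
  rw [← smul_sub, form_smul]

theorem formTendsto_const (f : T.domain) : FormTendsto T (fun _ => f) f := by
  refine ⟨tendsto_const_nhds, ?_⟩
  simp [form]

/-- The domain of the closure `q̄` of the form `q`: all limits of form-convergent sequences. -/
def closedFormDomain (hT : IsNonneg T) : Submodule ℂ H where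
  carrier := {f | ∃ u : ℕ → T.domain, FormTendsto T u f}
  zero_mem' := ⟨fun _ => 0, formTendsto_const 0⟩
  add_mem' := fun ⟨_, hu⟩ ⟨_, hv⟩ => ⟨_, hu.add hT hv⟩
  smul_mem' := fun c _ ⟨_, hu⟩ => ⟨_, hu.smul c⟩

theorem FormTendsto.form_self_tendsto_zero (hs : IsSymmetric T) (hT : IsNonneg T)
    {v : ℕ → T.domain} (hv : FormTendsto T v 0) :
    Tendsto (fun n => form T (v n) (v n)) atTop (𝓝 0) := by
  rw [Metric.tendsto_atTop]
  intro ε hε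
  obtain ⟨⟨N, M⟩, hN⟩ := Metric.tendsto_atTop.1 hv.2 (ε / 2) (half_pos hε)
  refine ⟨max N M, fun n hn => ?_⟩
  rw [dist_zero_right, norm_form_self hT]
  have hlim : Tendsto (fun m => ε / 2 + 2 * (form T (v n) (v m)).re) atTop
      (𝓝 (ε / 2 + 2 * 0)) := by
    refine tendsto_const_nhds.add (Tendsto.const_mul 2 ?_)
    have h1 : Tendsto (fun m => inner ℂ (T (v n)) (v m : H)) atTop (𝓝 (inner ℂ (T (v n)) 0)) :=
      tendsto_const_nhds.inner hv.1
    rw [inner_zero_right] at h1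
    have h2 := (Complex.continuous_re.tendsto 0).comp h1
    refine h2.congr fun m => ?_
    simp only [Function.comp, form, hs.inner_eq]
  have hle : (form T (v n) (v n)).re ≤ ε / 2 + 2 * 0 := by
    refine ge_of_tendsto hlim ?_
    filter_upwards [eventually_ge_atTop (max N M)] with m hm
    have h1 := hN (n, m) ⟨(le_max_left _ _).trans hn, (le_max_right _ _).trans hm⟩
    rw [dist_zero_right, norm_form_self hT] at h1
    have h2 := (hT (v m)).1
    change 0 ≤ (form T (v m) (v m)).re at h2
    have h3 : (form T (v m) (v n)).re = (form T (v n) (v m)).re := by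
      simp only [form]
      rw [← hs.inner_eq, ← inner_conj_symm, Complex.conj_re]
    simp only [sub_eq_add_neg, form_add_left, form_add_right, form_neg_left, form_neg_right,
      Complex.add_re, Complex.neg_re] at h1
    linarith
  linarith

theorem norm_form_sq_le (hs : IsSymmetric T) (hT : IsNonneg T) (f g : T.domain) :
    ‖form T f g‖ * ‖form T f g‖ ≤ ‖form T f f‖ * ‖form T g g‖ := by
  let c : PreInnerProductSpace.Core ℂ T.domain :=
    { inner := form T
      conj_inner_symm := fun x y => by
        change starRingEnd ℂ (form T y x) = form T x y
        simp only [form]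
        rw [inner_conj_symm, hs.inner_eq]
      re_inner_nonneg := fun x => (hT x).1
      add_left := fun x y z => form_add_left x y z
      smul_left := fun x y r => by
        change form T (r • x) y = _ * form T x y
        simp [form, mul_comm] }
  have h := @InnerProductSpace.Core.inner_mul_inner_self_le ℂ T.domain _ _ _ c f g
  change ‖form T f g‖ * ‖form T g f‖ ≤ (form T f f).re * (form T g g).re at h
  have h3 : ‖form T g f‖ = ‖form T f g‖ := by
    simp only [form]
    rw [← hs.inner_eq, ← inner_conj_symm, RCLike.norm_conj]
  rwa [h3, ← norm_form_self hT, ← norm_form_self hT] at h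

/-- The form `q` is closable. -/
theorem FormTendsto.form_tendsto_zero (hs : IsSymmetric T) (hT : IsNonneg T)
    {u v : ℕ → T.domain} {f : H} (hu : FormTendsto T u f) (hv : FormTendsto T v 0) :
    Tendsto (fun n => form T (u n) (v n)) atTop (𝓝 0) := by
  obtain ⟨⟨N, M⟩, hN⟩ := Metric.tendsto_atTop.1 hu.2 1 one_pos
  set C : ℝ := 2 * 1 + 2 * ‖form T (u M) (u M)‖
  have hlim : Tendsto (fun n => √(C * ‖form T (v n) (v n)‖)) atTop (𝓝 0) := by
    have h := ((hv.form_self_tendsto_zero hs hT).norm.const_mul C).sqrt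
    simpa using h
  refine squeeze_zero_norm' ?_ hlim
  filter_upwards [eventually_ge_atTop N] with n hn
  have h1 := hN (n, M) ⟨hn, le_rfl⟩
  rw [dist_zero_right] at h1
  have h2 : ‖form T (u n) (u n)‖ ≤ C := by
    have h := norm_form_add_le hT (u n - u M) (u M)
    rw [sub_add_cancel] at h
    have h1' : ‖form T (u n - u M) (u n - u M)‖ < 1 := h1
    simp only [C]
    linarith
  refine Real.le_sqrt_of_sq_le ?_
  rw [pow_two]
  exact (norm_form_sq_le hs hT _ _).trans (mul_le_mul_of_nonneg_right h2 (norm_nonneg _))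

variable (T) in
/-- `q̄(f, g) = c`, where `q̄` is the closure of the form `q`: one has `q(u n, v n) → c` whenever
`u` is form-convergent to `f` and `v` is form-convergent to `g`. -/
def ClosedFormEq (f g : H) (c : ℂ) : Prop :=
  ∀ u v : ℕ → T.domain, FormTendsto T u f → FormTendsto T v g →
    Tendsto (fun n => form T (u n) (v n)) atTop (𝓝 c)

/-- The operator associated with the closed form `q̄`, as a graph: `(f, h)` belongs to it when
`f ∈ dom q̄` and `q̄(g, f) = (g, h)` for all `g ∈ dom q̄`. -/
def friedrichsGraph (hs : IsSymmetric T) (hT : IsNonneg T) : Submodule ℂ (H × H) where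
  carrier := {p | p.1 ∈ closedFormDomain hT ∧
    ∀ g ∈ closedFormDomain hT, ClosedFormEq T g p.1 (inner ℂ g p.2)}
  zero_mem' := by
    refine ⟨zero_mem _, fun g _ u v hu hv => ?_⟩
    simpa using hu.form_tendsto_zero hs hT hv
  add_mem' := by
    rintro p q ⟨⟨v₁, hv₁⟩, hp⟩ ⟨⟨v₂, hv₂⟩, hq⟩
    refine ⟨⟨_, hv₁.add hT hv₂⟩, fun g hg u v hu hv => ?_⟩
    have hw := hv.add hT ((hv₁.add hT hv₂).smul (-1))
    have h0 : (p + q).1 + (-1 : ℂ) • (p.1 + q.1) = 0 := by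
      rw [Prod.fst_add]; module
    rw [h0] at hw
    have h := ((hp g hg u v₁ hu hv₁).add (hq g hg u v₂ hu hv₂)).add
      (hu.form_tendsto_zero hs hT hw)
    rw [add_zero, ← inner_add_right] at h
    refine h.congr fun n => ?_
    rw [← form_add_right, ← form_add_right]
    congr 1
    module
  smul_mem' := by
    rintro c p ⟨⟨v₁, hv₁⟩, hp⟩
    refine ⟨⟨_, hv₁.smul c⟩, fun g hg u v hu hv => ?_⟩
    have hw := hv.add hT ((hv₁.smul c).smul (-1))
    have h0 : (c • p).1 + (-1 : ℂ) • (c • p.1) = 0 := by simp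
    rw [h0] at hw
    have h := ((hp g hg u v₁ hu hv₁).const_mul c).add (hu.form_tendsto_zero hs hT hw)
    rw [add_zero, ← inner_smul_right] at h
    refine h.congr fun n => ?_
    have h1 : c * form T (u n) (v₁ n) = form T (u n) (c • v₁ n) := by
      simp [form, LinearPMap.map_smul]
    rw [h1, ← form_add_right]
    congr 1
    module

/-- The Friedrichs extension of a nonnegative symmetric operator `T`: the operator associated with
the closure of the form `q(f, g) = (f, T g)`, `f, g ∈ dom T`. -/
noncomputable def friedrichsExtension (hs : IsSymmetric T) (hT : IsNonneg T) : H →ₗ.[ℂ] H :=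
  (friedrichsGraph hs hT).toLinearPMap

/-- The associated graph is single-valued, so it is the graph of the Friedrichs extension. -/
theorem friedrichsExtension_graph (hs : IsSymmetric T) (hT : IsNonneg T) :
    (friedrichsExtension hs hT).graph = friedrichsGraph hs hT := by
  refine Submodule.toLinearPMap_graph_eq _ ?_
  rintro ⟨f, h⟩ ⟨_, hx⟩ (hf : f = 0)
  subst hf
  refine hs.dense.eq_zero_of_inner_right ℂ fun g hg => ?_
  have hc := formTendsto_const (T := T) ⟨g, hg⟩
  have h0 := formTendsto_const (T := T) 0
  have h1 := hx g ⟨_, hc⟩ _ _ hc h0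
  have h2 : form T ⟨g, hg⟩ 0 = 0 := by simp [form]
  rw [h2] at h1
  exact (tendsto_nhds_unique tendsto_const_nhds h1).symm

end Form

theorem opSq_apply (S : H →ₗ.[ℂ] H) (f : (opSq S).domain) :
    ∃ g k : S.domain, (g : H) = f ∧ (k : H) = S g ∧ opSq S f = S k := by
  obtain ⟨k', h1, h2⟩ := (mem_opMul_graph S S f (opSq S f)).1 ((opSq S).mem_graph f)
  obtain ⟨g, hg, rfl⟩ := (LinearPMap.mem_graph_iff S).1 h1
  obtain ⟨k, hk, hk'⟩ := (LinearPMap.mem_graph_iff S).1 h2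
  exact ⟨g, k, hg, hk, hk'.symm⟩

/-- If `S` is symmetric and `dom S²` is dense, then `S²` is symmetric. -/
theorem IsSymmetric.isSymmetric_opSq {S : H →ₗ.[ℂ] H} (hS : IsSymmetric S)
    (hd : Dense ((opSq S).domain : Set H)) : IsSymmetric (opSq S) := by
  refine ⟨hd, fun f g => ?_⟩
  obtain ⟨f₁, f₂, h1, h2, h3⟩ := opSq_apply S f
  obtain ⟨g₁, g₂, h4, h5, h6⟩ := opSq_apply S g
  rw [h3, h6, ← h1, ← h4, hS.inner_eq, h2, ← h5, hS.inner_eq]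

/-- If `S` is symmetric, then `S² ≥ 0`. -/
theorem IsSymmetric.isNonneg_opSq {S : H →ₗ.[ℂ] H} (hS : IsSymmetric S) : IsNonneg (opSq S) := by
  intro f
  obtain ⟨f₁, f₂, h1, h2, h3⟩ := opSq_apply S f
  have : inner ℂ (f : H) (opSq S f) = ((‖S f₁‖ ^ 2 : ℝ) : ℂ) := by
    rw [h3, ← h1, ← hS.inner_eq, h2, inner_self_eq_norm_sq_to_K]
    simp
  rw [this]
  exact ⟨by rw [Complex.ofReal_re]; positivity, Complex.ofReal_im _⟩

end FriedrichsSquare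

/-!
Write `D = dom S²` and `R = closure of S|D`.

On `D` the form of `S²` is `(f, S² g) = (S f, S g)`, so a sequence is form-convergent exactly when
it converges in the graph norm of `S`. Hence the closed form has domain `dom R` and value `(R f, R
g)`, and the operator associated with it is `R* R` (`friedrichsExtension_eq_of_form_eq`). For
closed densely defined `R`, the orthogonal projection of `(h, 0)` to the graph of `R` writes every
`h` as `f + R* R f`; from this it follows that `R* R` is self-adjoint and that its domain is a core
for `R` (`isSelfAdjoint_adjoint_mul_self`, `graph_le_closure_adjoint_mul_self`). The last fact,
applied to `S̄`, shows that `R ≤ S̄` can only satisfy `R* R = S̄* S̄` when `R = S̄`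
(`friedrichsExtension_opSq_eq_iff`).

Let `S` be closed and `N = ran (S - z)ᗮ` be finite-dimensional, with `z = i` or `z = -i`. Then `S -
z` is an isometry from `dom S` with the graph norm onto the closed subspace `Nᗮ`, and it maps `dom
S²` onto `dom S ∩ Nᗮ`. A dense subspace is still dense in `Nᗮ` after intersecting with it, because
`N` has finite dimension (`orthogonal_le_closure_inf`), so `dom S²` is a core.

For the operator whose square has a domain that is dense but not a core, let `K` be an injective
bounded self-adjoint operator in `E`, let `G : F → E` be bounded, and put `S (K u, K k, G* k) = (k,
u, 0)` in `E ⊕ E ⊕ F`. This operator is closed and symmetric, and `dom S²` consists of the vectors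
`(K² k, K² u, G* K u)` with `k` in `ker G* = (ran G)ᗮ`. The second component of `S` on `dom S²` is
then in `K (ker G*)`. So `dom S²` is not a core if the closure of `ran G` contains some `K x ≠ 0`,
and it is dense if `G` is injective, `ran G ∩ ran K = 0`, and the closure of `ran G` meets `ran K²`
trivially. All of this is achieved in sequence spaces: with weights `w = (1 / (i + 1))_i ∈ ℓ²`, `K`
multiplies each row of `ℓ²(Option ℕ × ℕ)` by `w`, and `G` maps the `j`-th unit vector to `w_j n +
w_j² e_j`, where `e_j`, a copy of `w` in row `j`, is outside `ran K`, and `n`, a copy of `w²` in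
the extra row, is in `ran K` but not in `ran K²`. Dividing by `w_j` and letting `j → ∞` shows that
`n` is in the closure of `ran G`.
-/

namespace FriedrichsSquare

open scoped LinearPMap

section General

variable {H : Type*} [NormedAddCommGroup H] [InnerProductSpace ℂ H]

/-! ### Graphs, adjoints and closures -/

theorem mem_graph_domRestrict {T : H →ₗ.[ℂ] H} {D : Submodule ℂ H} {a b : H} :
    (a, b) ∈ (T.domRestrict D).graph ↔ a ∈ D ∧ (a, b) ∈ T.graph := by
  simp only [LinearPMap.mem_graph_iff]
  constructor
  · rintro ⟨x, rfl, rfl⟩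
    exact ⟨x.2.1, ⟨x, x.2.2⟩, rfl, (LinearPMap.domRestrict_apply rfl).symm⟩
  · rintro ⟨ha, x, rfl, rfl⟩
    exact ⟨⟨x, ha, x.2⟩, rfl, LinearPMap.domRestrict_apply rfl⟩

theorem mem_graph_closure_iff_seq {T : H →ₗ.[ℂ] H} (hT : T.IsClosable) {f g : H} :
    (f, g) ∈ T.closure.graph ↔ ∃ u : ℕ → T.domain,
      Tendsto (fun n => (u n : H)) atTop (𝓝 f) ∧ Tendsto (fun n => T (u n)) atTop (𝓝 g) := by
  rw [← hT.graph_closure_eq_closure_graph, ← SetLike.mem_coe, Submodule.topologicalClosure_coe,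
    mem_closure_iff_seq_limit]
  constructor
  · rintro ⟨p, hp, hlim⟩
    choose u hu1 hu2 using fun n => (LinearPMap.mem_graph_iff T).1 (hp n)
    rw [Prod.tendsto_iff] at hlim
    exact ⟨u, by simpa only [hu1] using hlim.1, by simpa only [hu2] using hlim.2⟩
  · rintro ⟨u, h1, h2⟩
    exact ⟨fun n => (u n, T (u n)), fun n => T.mem_graph _, h1.prodMk_nhds h2⟩

theorem closure_eq_of_isClosed {T : H →ₗ.[ℂ] H} (hT : T.IsClosed) : T.closure = T :=
  LinearPMap.eq_of_eq_graph <| by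
    rw [← hT.isClosable.graph_closure_eq_closure_graph]
    exact IsClosed.submodule_topologicalClosure_eq hT

/-- Orthogonal projection to a closed subspace of `H × H`, such as the graph of a closed operator,
for the inner product of the Hilbert sum `H ⊕ H`, which the type `H × H` does not carry. -/
theorem exists_orthogonal_residual [CompleteSpace H] (C : Submodule ℂ (H × H))
    (hC : IsClosed (C : Set (H × H))) (p : H × H) :
    ∃ q ∈ C, ∀ r ∈ C, inner ℂ r.1 (p.1 - q.1) + inner ℂ r.2 (p.2 - q.2) = 0 := by
  let e : WithLp 2 (H × H) →L[ℂ] H × H := (WithLp.prodContinuousLinearEquiv 2 ℂ H H : _ →L[ℂ] _)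
  let C' : Submodule ℂ (WithLp 2 (H × H)) := C.comap e.toLinearMap
  have hC' : IsClosed (C' : Set (WithLp 2 (H × H))) := hC.preimage e.continuous
  have : CompleteSpace C' := hC'.completeSpace_coe
  obtain ⟨q, hq, w, hw, hp⟩ := C'.exists_add_mem_mem_orthogonal (WithLp.toLp 2 p)
  obtain rfl : w = WithLp.toLp 2 p - q := by rw [hp]; abel
  exact ⟨q.ofLp, hq, fun r hr => hw (WithLp.toLp 2 r) hr⟩

theorem opSq_domain_le (S : H →ₗ.[ℂ] H) : (opSq S).domain ≤ S.domain :=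
  Submodule.map_subtype_le _ _

theorem mem_opSq_domain_iff {S : H →ₗ.[ℂ] H} {f : H} :
    f ∈ (opSq S).domain ↔ ∃ g ∈ S.domain, (f, g) ∈ S.graph := by
  rw [LinearPMap.mem_domain_iff]
  simp only [opSq, mem_opMul_graph, S.mem_domain_iff]
  exact ⟨fun ⟨h, g, h1, h2⟩ => ⟨g, ⟨h, h2⟩, h1⟩, fun ⟨g, ⟨h, h2⟩, h1⟩ => ⟨h, g, h1, h2⟩⟩

theorem dense_domRestrict_opSq {S : H →ₗ.[ℂ] H} (hd : Dense ((opSq S).domain : Set H)) :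
    Dense ((S.domRestrict (opSq S).domain).domain : Set H) :=
  hd.mono fun _ hx => ⟨hx, opSq_domain_le S hx⟩

variable [CompleteSpace H]

theorem mem_graph_adjoint_iff {T : H →ₗ.[ℂ] H} (hT : Dense (T.domain : Set H)) {y z : H} :
    (y, z) ∈ T†.graph ↔ ∀ a b, (a, b) ∈ T.graph → inner ℂ b y = inner ℂ a z := by
  simp [LinearPMap.adjoint_graph_eq_graph_adjoint hT, Submodule.mem_adjoint_iff, sub_eq_zero,
    -LinearPMap.mem_graph_iff]

theorem closure_adjoint {T : H →ₗ.[ℂ] H} (hT : Dense (T.domain : Set H)) (hc : T.IsClosable) :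
    T.closure† = T† := by
  apply LinearPMap.eq_of_eq_graph
  ext ⟨y, z⟩
  rw [mem_graph_adjoint_iff hT, mem_graph_adjoint_iff (hT.mono T.le_closure.1)]
  constructor
  · exact fun h a b hab => h a b (LinearPMap.le_graph_of_le T.le_closure hab)
  · intro h a b hab
    obtain ⟨u, h1, h2⟩ := (mem_graph_closure_iff_seq hc).1 hab
    refine tendsto_nhds_unique (h2.inner (𝕜 := ℂ) (tendsto_const_nhds (x := y))) ?_
    simp only [h _ _ (T.mem_graph _)]
    exact h1.inner tendsto_const_nhds

theorem IsSymmetric.le_adjoint {S : H →ₗ.[ℂ] H} (hS : IsSymmetric S) : S ≤ S† :=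
  LinearPMap.IsFormalAdjoint.le_adjoint hS.dense hS.inner_eq

theorem IsSymmetric.isClosable {S : H →ₗ.[ℂ] H} (hS : IsSymmetric S) : S.IsClosable :=
  LinearPMap.isClosable_iff_exists_closed_extension.2
    ⟨S†, LinearPMap.adjoint_isClosed hS.dense, hS.le_adjoint⟩

theorem IsSymmetric.closure_le_adjoint {S : H →ₗ.[ℂ] H} (hS : IsSymmetric S) :
    S.closure ≤ S† := by
  rw [← closure_eq_of_isClosed (LinearPMap.adjoint_isClosed hS.dense)]
  exact (LinearPMap.adjoint_isClosed hS.dense).isClosable.closure_mono hS.le_adjoint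

theorem IsSymmetric.closure {S : H →ₗ.[ℂ] H} (hS : IsSymmetric S) : IsSymmetric S.closure := by
  have hd : Dense (S.closure.domain : Set H) := hS.dense.mono S.le_closure.1
  refine ⟨hd, fun _ g => ?_⟩
  have h := LinearPMap.le_graph_of_le hS.closure_le_adjoint (S.closure.mem_graph g)
  rw [← closure_adjoint hS.dense hS.isClosable, mem_graph_adjoint_iff hd] at h
  exact h _ _ (S.closure.mem_graph _)

/-! ### The operator `R* R` for a closed densely defined `R` -/

section AdjointMulSelf

variable {R : H →ₗ.[ℂ] H}

/-- `1 + R* R` is onto: with `(f, R f)` the orthogonal projection of `(h, 0)` to the graph of `R`,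
the residual `(h - f, -R f)` is orthogonal to the graph, which says that `R* R f = h - f`. -/
theorem exists_add_adjoint_mul_self (hd : Dense (R.domain : Set H)) (hc : R.IsClosed) (h : H) :
    ∃ f g k, (f, g) ∈ R.graph ∧ (g, k) ∈ R†.graph ∧ f + k = h := by
  obtain ⟨⟨f, g⟩, hq, hr⟩ := exists_orthogonal_residual R.graph hc (h, 0)
  refine ⟨f, g, h - f, hq, (mem_graph_adjoint_iff hd).2 fun a b hab => ?_, by abel⟩
  have := hr _ hab
  simp only [zero_sub, inner_neg_right] at this
  exact (sub_eq_zero.1 (by rw [sub_eq_add_neg]; exact this)).symm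

theorem isSymmetric_adjoint_mul_self (hd : Dense (R.domain : Set H)) (hc : R.IsClosed) :
    IsSymmetric (opMul R† R) := by
  constructor
  · rw [Submodule.dense_iff_topologicalClosure_eq_top, Submodule.topologicalClosure_eq_top_iff,
      Submodule.eq_bot_iff]
    intro h hh
    obtain ⟨f, g, k, hfg, hgk, rfl⟩ := exists_add_adjoint_mul_self hd hc h
    have h1 := hh f (LinearPMap.mem_domain_of_mem_graph ((mem_opMul_graph _ _ f k).2 ⟨g, hfg, hgk⟩))
    rw [inner_add_right, ← (mem_graph_adjoint_iff hd).1 hgk f g hfg,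
      inner_self_eq_norm_sq_to_K, inner_self_eq_norm_sq_to_K] at h1
    have h2 : ‖f‖ ^ 2 + ‖g‖ ^ 2 = 0 := RCLike.ofReal_eq_zero (K := ℂ).1 (by push_cast; exact h1)
    have hf : f = 0 := norm_eq_zero.1 (pow_eq_zero_iff two_ne_zero |>.1
      (by linarith [sq_nonneg ‖f‖, sq_nonneg ‖g‖]))
    subst hf
    obtain rfl := LinearPMap.graph_fst_eq_zero_snd R hfg rfl
    rw [LinearPMap.graph_fst_eq_zero_snd R† hgk rfl, add_zero]
  · intro f a
    obtain ⟨g, hfg, hg⟩ := (mem_opMul_graph _ _ _ _).1 ((opMul R† R).mem_graph f)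
    obtain ⟨b, hab, hb⟩ := (mem_opMul_graph _ _ _ _).1 ((opMul R† R).mem_graph a)
    rw [← (mem_graph_adjoint_iff hd).1 hb _ _ hfg, ← inner_conj_symm,
      ← (mem_graph_adjoint_iff hd).1 hg _ _ hab, inner_conj_symm]

theorem isNonneg_adjoint_mul_self (hd : Dense (R.domain : Set H)) : IsNonneg (opMul R† R) := by
  intro f
  obtain ⟨g, hfg, hg⟩ := (mem_opMul_graph _ _ _ _).1 ((opMul R† R).mem_graph f)
  rw [← (mem_graph_adjoint_iff hd).1 hg _ _ hfg]
  exact ⟨inner_self_nonneg (𝕜 := ℂ), inner_self_im (𝕜 := ℂ) g⟩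

/-- **Von Neumann's theorem**: `R* R` is self-adjoint for closed densely defined `R`. If `y`
is in the domain of the adjoint of `R* R` with value `z`, and `f + R* R f = y + z`, then `y - f` is
orthogonal to the range of `1 + R* R`, which is everything. -/
theorem isSelfAdjoint_adjoint_mul_self (hd : Dense (R.domain : Set H)) (hc : R.IsClosed) :
    IsSelfAdjoint (opMul R† R) := by
  have hs := isSymmetric_adjoint_mul_self hd hc
  refine LinearPMap.isSelfAdjoint_def.2 (le_antisymm (LinearPMap.le_of_le_graph ?_) hs.le_adjoint)
  rintro ⟨y, z⟩ hyz
  obtain ⟨f, g, k, hfg, hgk, hk⟩ := exists_add_adjoint_mul_self hd hc (y + z)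
  have hfk := (mem_opMul_graph _ _ f k).2 ⟨g, hfg, hgk⟩
  have h0 : y - f = 0 := by
    obtain ⟨a, b, c, hab, hbc, hc⟩ := exists_add_adjoint_mul_self hd hc (y - f)
    have hac := (mem_opMul_graph _ _ a c).2 ⟨b, hab, hbc⟩
    have h1 := (mem_graph_adjoint_iff hs.dense).1 hyz _ _ hac
    have h2 := (mem_graph_adjoint_iff hs.dense).1
      (LinearPMap.le_graph_of_le hs.le_adjoint hfk) _ _ hac
    rw [← inner_self_eq_zero (𝕜 := ℂ)]
    nth_rewrite 1 [← hc]
    rw [inner_add_left, inner_sub_right, inner_sub_right, h1, h2, ← inner_sub_right,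
      ← inner_sub_right, ← inner_add_right]
    rw [show y - f + (z - k) = y + z - (f + k) by abel, hk, sub_self, inner_zero_right]
  obtain rfl := sub_eq_zero.1 h0
  rwa [← add_left_cancel hk]

/-- The domain of `R* R` is a core for `R`: a vector of the graph of `R` which is orthogonal to all
`(f, R f)`, `f ∈ dom (R* R)`, has its first component orthogonal to the range of `1 + R* R`. -/
theorem graph_le_closure_adjoint_mul_self (hd : Dense (R.domain : Set H)) (hc : R.IsClosed) :
    R.graph ≤ (R.domRestrict (opMul R† R).domain).graph.topologicalClosure := by
  set C := (R.domRestrict (opMul R† R).domain).graph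
  rintro p hp
  obtain ⟨q, hq, hr⟩ := exists_orthogonal_residual C.topologicalClosure
    C.isClosed_topologicalClosure p
  have hqR : q ∈ R.graph := by
    rw [← IsClosed.submodule_topologicalClosure_eq hc]
    exact Submodule.topologicalClosure_mono (LinearPMap.le_graph_of_le R.domRestrict_le) hq
  have hpq : p - q ∈ R.graph := sub_mem hp hqR
  have h0 : (p - q).1 = 0 := by
    obtain ⟨f, g, k, hfg, hgk, hk⟩ := exists_add_adjoint_mul_self hd hc (p - q).1
    have hC : (f, g) ∈ C := mem_graph_domRestrict.2
      ⟨LinearPMap.mem_domain_of_mem_graph ((mem_opMul_graph _ _ f k).2 ⟨g, hfg, hgk⟩), hfg⟩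
    have h1 : inner ℂ f (p - q).1 + inner ℂ g (p - q).2 = 0 :=
      hr _ (C.le_topologicalClosure hC)
    have h2 := (mem_graph_adjoint_iff hd).1 hgk (p - q).1 (p - q).2 hpq
    rw [← inner_self_eq_zero (𝕜 := ℂ)]
    nth_rewrite 1 [← hk]
    rw [inner_add_left, ← inner_conj_symm k, ← h2, inner_conj_symm, h1]
  have h2 := LinearPMap.graph_fst_eq_zero_snd R (x := (p - q).1) (x' := (p - q).2) hpq h0
  rwa [sub_eq_zero.1 (Prod.ext h0 h2 : p - q = 0)]

end AdjointMulSelf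

/-! ### The Friedrichs extension -/

/-- If `(f, T g) = (A f, A g)` on `dom T`, then form convergence is graph convergence for `A`. -/
theorem formTendsto_iff_of_form_eq {T : H →ₗ.[ℂ] H} {A : T.domain →ₗ[ℂ] H}
    (hA : ∀ f g, form T f g = inner ℂ (A f) (A g)) {u : ℕ → T.domain} {f : H} :
    FormTendsto T u f ↔ Tendsto (fun n => (u n : H)) atTop (𝓝 f) ∧
      ∃ g, Tendsto (fun n => A (u n)) atTop (𝓝 g) := by
  have key : ∀ p : ℕ × ℕ, ‖form T (u p.1 - u p.2) (u p.1 - u p.2)‖ =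
      dist (A (u p.1)) (A (u p.2)) ^ 2 := fun p => by
    rw [hA, inner_self_eq_norm_sq_to_K, map_sub, dist_eq_norm]
    simp
  have hC : Tendsto (fun p : ℕ × ℕ => form T (u p.1 - u p.2) (u p.1 - u p.2)) atTop (𝓝 0) ↔
      CauchySeq fun n => A (u n) := by
    rw [cauchySeq_iff_tendsto_dist_atTop_0, tendsto_zero_iff_norm_tendsto_zero]
    simp only [key]
    constructor
    · intro h
      simpa using h.sqrt
    · intro h
      simpa using h.pow 2
  rw [FormTendsto, hC]
  exact and_congr_right fun _ => ⟨cauchySeq_tendsto_of_complete, fun ⟨_, h⟩ => h.cauchySeq⟩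

/-- If the form of `T` is `(A f, A g)` and the closure of `A` is the operator `R`, then the
Friedrichs extension of `T` is `R* R`. -/
theorem friedrichsExtension_eq_of_form_eq {T R : H →ₗ.[ℂ] H} (hs : IsSymmetric T) (hT : IsNonneg T)
    {A : T.domain →ₗ[ℂ] H} (hA : ∀ f g, form T f g = inner ℂ (A f) (A g))
    (hR : ∀ f g, (f, g) ∈ R.graph ↔ ∃ u : ℕ → T.domain,
      Tendsto (fun n => (u n : H)) atTop (𝓝 f) ∧ Tendsto (fun n => A (u n)) atTop (𝓝 g)) :
    friedrichsExtension hs hT = opMul R† R := by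
  have hd : Dense (R.domain : Set H) := hs.dense.mono fun f hf =>
    LinearPMap.mem_domain_of_mem_graph ((hR f (A ⟨f, hf⟩)).2
      ⟨fun _ => ⟨f, hf⟩, tendsto_const_nhds, tendsto_const_nhds⟩)
  apply LinearPMap.eq_of_eq_graph
  rw [friedrichsExtension_graph]
  ext ⟨f, h⟩
  rw [mem_opMul_graph]
  constructor
  · rintro ⟨⟨v, hv⟩, hq⟩
    obtain ⟨h1, g, h2⟩ := (formTendsto_iff_of_form_eq hA).1 hv
    refine ⟨g, (hR f g).2 ⟨v, h1, h2⟩, (mem_graph_adjoint_iff hd).2 fun a b hab => ?_⟩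
    obtain ⟨u, h3, h4⟩ := (hR a b).1 hab
    have hu : FormTendsto T u a := (formTendsto_iff_of_form_eq hA).2 ⟨h3, b, h4⟩
    have hlim := hq a ⟨u, hu⟩ u v hu hv
    simp only [hA] at hlim
    exact tendsto_nhds_unique (h4.inner h2) hlim
  · rintro ⟨g, hfg, hgh⟩
    obtain ⟨v, h1, h2⟩ := (hR f g).1 hfg
    refine ⟨⟨v, (formTendsto_iff_of_form_eq hA).2 ⟨h1, g, h2⟩⟩, fun a _ u w hu hw => ?_⟩
    obtain ⟨h3, b, h4⟩ := (formTendsto_iff_of_form_eq hA).1 hu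
    obtain ⟨h5, g', h6⟩ := (formTendsto_iff_of_form_eq hA).1 hw
    obtain rfl := LinearPMap.mem_graph_snd_inj R ((hR f g').2 ⟨w, h5, h6⟩) hfg rfl
    have hlim := h4.inner (𝕜 := ℂ) h6
    rw [(mem_graph_adjoint_iff hd).1 hgh a b ((hR a b).2 ⟨u, h3, h4⟩)] at hlim
    simpa only [hA] using hlim

/-! ### The square of a symmetric operator -/

theorem IsSymmetric.isClosable_domRestrict {S : H →ₗ.[ℂ] H} (hS : IsSymmetric S)
    (D : Submodule ℂ H) : (S.domRestrict D).IsClosable :=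
  hS.isClosable.leIsClosable LinearPMap.domRestrict_le

theorem friedrichsExtension_opSq {S : H →ₗ.[ℂ] H} (hS : IsSymmetric S)
    (hd : Dense ((opSq S).domain : Set H)) :
    friedrichsExtension (hS.isSymmetric_opSq hd) hS.isNonneg_opSq =
      opMul (S.domRestrict (opSq S).domain).closure† (S.domRestrict (opSq S).domain).closure := by
  refine friedrichsExtension_eq_of_form_eq (A := S.toFun ∘ₗ Submodule.inclusion (opSq_domain_le S))
    _ _ (fun f g => ?_) (fun f g => ?_)
  · obtain ⟨g₁, g₂, h4, h5, h6⟩ := opSq_apply S g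
    obtain rfl : Submodule.inclusion (opSq_domain_le S) g = g₁ := Subtype.ext h4.symm
    change inner ℂ (f : H) (opSq S g) = inner ℂ (S _) (S _)
    rw [h6, ← h5, hS.inner_eq]
    rfl
  · rw [mem_graph_closure_iff_seq (hS.isClosable_domRestrict _)]
    constructor
    · rintro ⟨u, h1, h2⟩
      exact ⟨fun n => ⟨u n, (u n).2.1⟩, h1, h2⟩
    · rintro ⟨u, h1, h2⟩
      exact ⟨fun n => ⟨u n, (u n).2, opSq_domain_le S (u n).2⟩, h1, h2⟩

/-- `S² ≤ R* R`, because `R ≤ S̄ ≤ S*`. -/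
theorem opSq_le_adjoint_mul_self {S : H →ₗ.[ℂ] H} (hS : IsSymmetric S)
    (hd : Dense ((opSq S).domain : Set H)) :
    opSq S ≤ opMul (S.domRestrict (opSq S).domain).closure†
      (S.domRestrict (opSq S).domain).closure := by
  refine LinearPMap.le_of_le_graph ?_
  rintro ⟨f, h⟩ hfh
  obtain ⟨g, hfg, hgh⟩ := (mem_opMul_graph S S f h).1 hfh
  rw [mem_opMul_graph]
  have hf := LinearPMap.mem_domain_of_mem_graph hfh
  have hd' := dense_domRestrict_opSq hd
  refine ⟨g, LinearPMap.le_graph_of_le (LinearPMap.le_closure _)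
    (mem_graph_domRestrict.2 ⟨hf, hfg⟩), ?_⟩
  rw [closure_adjoint hd' (hS.isClosable_domRestrict _), mem_graph_adjoint_iff hd']
  intro a b hab
  exact (mem_graph_adjoint_iff hS.dense).1 (LinearPMap.le_graph_of_le hS.le_adjoint hgh) a b
    (LinearPMap.le_graph_of_le LinearPMap.domRestrict_le hab)

/-- If `R* R = S̄* S̄`, then the restriction of `S̄` to `dom (S̄* S̄)`, whose closure is `S̄`, is a
restriction of `R`. -/
theorem friedrichsExtension_opSq_eq_iff {S : H →ₗ.[ℂ] H} (hS : IsSymmetric S)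
    (hd : Dense ((opSq S).domain : Set H)) :
    friedrichsExtension (hS.isSymmetric_opSq hd) hS.isNonneg_opSq = opMul S† S.closure ↔
      IsCore S (opSq S).domain := by
  rw [friedrichsExtension_opSq hS hd, ← closure_adjoint hS.dense hS.isClosable]
  set R := (S.domRestrict (opSq S).domain).closure
  have hRS : R ≤ S.closure := hS.isClosable.closure_mono LinearPMap.domRestrict_le
  refine ⟨fun h => ⟨opSq_domain_le S, le_antisymm hRS (LinearPMap.le_of_le_graph ?_)⟩,
    fun h => by rw [show R = S.closure from h.2]⟩
  have hRc : R.IsClosed := (hS.isClosable_domRestrict _).closure_isClosed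
  refine (graph_le_closure_adjoint_mul_self hS.closure.dense
    hS.isClosable.closure_isClosed).trans (Submodule.topologicalClosure_minimal _ ?_ hRc)
  rintro ⟨f, g⟩ hfg
  obtain ⟨hf, hfg⟩ := mem_graph_domRestrict.1 hfg
  rw [← h, LinearPMap.mem_domain_iff] at hf
  obtain ⟨k, hk⟩ := hf
  obtain ⟨g', hg', -⟩ := (mem_opMul_graph _ _ f k).1 hk
  rwa [← LinearPMap.mem_graph_snd_inj S.closure (LinearPMap.le_graph_of_le hRS hg') hfg rfl]

end General

/-! ### Finite deficiency index -/

section FiniteDeficiency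

variable {H : Type*} [NormedAddCommGroup H] [InnerProductSpace ℂ H]

theorem IsSymmetric.norm_sub_smul_sq {T : H →ₗ.[ℂ] H} (hT : IsSymmetric T) {z : ℂ} (hz : z.re = 0)
    (hz1 : ‖z‖ = 1) (f : T.domain) : ‖T f - z • (f : H)‖ ^ 2 = ‖T f‖ ^ 2 + ‖(f : H)‖ ^ 2 := by
  have him : (inner ℂ (T f) (f : H)).im = 0 := by
    rw [← Complex.conj_eq_iff_im, inner_conj_symm, hT.inner_eq]
  rw [norm_sub_sq (𝕜 := ℂ), inner_smul_right, norm_smul, hz1, one_mul]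
  simp [hz, him]

/-- A dense subspace meets the orthogonal complement of a finite-dimensional subspace `N` densely:
an approximation from `V` is corrected by a linear section `N → V` of the projection onto `N`. -/
theorem orthogonal_le_closure_inf {V N : Submodule ℂ H} (hV : Dense (V : Set H))
    [FiniteDimensional ℂ N] : Nᗮ ≤ (V ⊓ Nᗮ).topologicalClosure := by
  let P : H →L[ℂ] N := N.orthogonalProjectionOnto
  let PV : V →ₗ[ℂ] N := P.toLinearMap ∘ₗ V.subtype
  have hPV : LinearMap.range PV = ⊤ := by
    have hclosed : IsClosed (LinearMap.range PV : Set N) := Submodule.closed_of_finiteDimensional _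
    have hP : Function.Surjective P := fun x => ⟨x, by simp [P]⟩
    have hdense : Dense (LinearMap.range PV : Set N) := by
      refine (hP.denseRange.dense_image P.continuous hV).mono ?_
      rintro _ ⟨v, hv, rfl⟩
      exact ⟨⟨v, hv⟩, rfl⟩
    rw [← SetLike.coe_set_eq, ← hclosed.closure_eq, hdense.closure_eq]
    rfl
  obtain ⟨σ, hσ⟩ := PV.exists_rightInverse_of_surjective hPV
  have hσ' : ∀ n, P (σ n : H) = n := fun n => LinearMap.congr_fun hσ n
  have hσc : Continuous (V.subtype ∘ₗ σ) := LinearMap.continuous_of_finiteDimensional _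
  have hΦc : Continuous fun v : H => v - σ (P v) :=
    continuous_id.sub (hσc.comp P.continuous)
  intro x hx
  have hPx : P x = 0 := Submodule.orthogonalProjectionOnto_apply_of_mem_orthogonal hx
  have h := image_closure_subset_closure_image hΦc ⟨x, hV x, rfl⟩
  simp only [hPx, map_zero, ZeroMemClass.coe_zero, sub_zero] at h
  refine closure_mono ?_ h
  rintro _ ⟨v, hv, rfl⟩
  refine ⟨sub_mem hv (σ _).2, ?_⟩
  rw [SetLike.mem_coe, ← Submodule.orthogonalProjectionOnto_eq_zero_iff]
  change P _ = 0
  rw [map_sub, hσ', sub_self]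

variable [CompleteSpace H]

/-- A closed symmetric operator `T` with a finite-dimensional defect subspace `N = ran (T - z)ᗮ` has
`dom T²` as a core. Indeed `T - z` carries the graph norm of `T` to the norm of the closed subspace
`ran (T - z) = Nᗮ` and `dom T²` to `dom T ∩ Nᗮ`, which is dense in `Nᗮ`. -/
theorem IsSymmetric.graph_le_closure_of_finiteDimensional {T : H →ₗ.[ℂ] H} (hT : IsSymmetric T)
    (hc : T.IsClosed) {z : ℂ} (hz : z.re = 0) (hz1 : ‖z‖ = 1)
    (hfin : FiniteDimensional ℂ (defectSubspace T z)) :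
    T.graph ≤ (T.domRestrict (opSq T).domain).graph.topologicalClosure := by
  let φ : T.graph →L[ℂ] H := ((ContinuousLinearMap.snd ℂ H H) -
    z • (ContinuousLinearMap.fst ℂ H H)).comp T.graph.subtypeL
  -- The type `H × H` carries the maximum norm, which the graph norm dominates.
  have hφ : ∀ p, ‖p‖ ≤ ‖φ p‖ := by
    rintro ⟨⟨f, g⟩, hfg⟩
    obtain ⟨f, rfl, rfl⟩ := (LinearPMap.mem_graph_iff T).1 hfg
    have h := hT.norm_sub_smul_sq hz hz1 f
    change max ‖(f : H)‖ ‖T f‖ ≤ ‖T f - z • (f : H)‖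
    refine max_le ?_ ?_ <;> refine le_of_sq_le_sq ?_ (norm_nonneg _) <;>
      linarith [sq_nonneg ‖T f‖, sq_nonneg ‖(f : H)‖]
  have : CompleteSpace T.graph := IsClosed.completeSpace_coe (hs := hc)
  have hM : LinearMap.range (T.toFun - z • T.domain.subtype) = LinearMap.range φ.toLinearMap := by
    ext y
    constructor
    · rintro ⟨f, rfl⟩
      exact ⟨⟨_, T.mem_graph f⟩, rfl⟩
    · rintro ⟨⟨⟨f, g⟩, hfg⟩, rfl⟩
      obtain ⟨f, rfl, rfl⟩ := (LinearPMap.mem_graph_iff T).1 hfg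
      exact ⟨f, rfl⟩
  have hMc : IsClosed (LinearMap.range φ.toLinearMap : Set H) :=
    (φ.antilipschitz_of_bound (K := 1) fun p => by simpa using hφ p).isClosed_range
      φ.uniformContinuous
  have hNM : (defectSubspace T z)ᗮ = LinearMap.range φ.toLinearMap := by
    rw [defectSubspace, hM, Submodule.orthogonal_orthogonal_eq_closure,
      IsClosed.submodule_topologicalClosure_eq hMc]
  intro p hp
  have hmem : φ ⟨p, hp⟩ ∈ (defectSubspace T z)ᗮ := hNM ▸ ⟨⟨p, hp⟩, rfl⟩
  have hcl := orthogonal_le_closure_inf hT.dense hmem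
  rw [hNM, ← SetLike.mem_coe, Submodule.topologicalClosure_coe, mem_closure_iff_seq_limit] at hcl
  obtain ⟨y, hy, hlim⟩ := hcl
  choose hyT u hu using hy
  rw [← SetLike.mem_coe, Submodule.topologicalClosure_coe, mem_closure_iff_seq_limit]
  refine ⟨fun n => u n, fun n => mem_graph_domRestrict.2 ⟨?_, (u n).2⟩, ?_⟩
  · have hdom : (u n : H × H).1 ∈ T.domain := LinearPMap.mem_domain_of_mem_graph (u n).2
    refine mem_opSq_domain_iff.2 ⟨(u n : H × H).2, ?_, (u n).2⟩
    -- `T f = (T - z) f + z f` is in `dom T` if `(T - z) f` is.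
    have : (u n : H × H).2 = y n + z • (u n : H × H).1 := by
      rw [← hu n]
      exact (sub_add_cancel _ _).symm
    rw [this]
    exact add_mem (hyT n) (T.domain.smul_mem z hdom)
  · rw [tendsto_iff_norm_sub_tendsto_zero] at hlim ⊢
    refine squeeze_zero (fun _ => norm_nonneg _) (fun n => ?_) hlim
    rw [← hu n]
    exact (hφ (u n - ⟨p, hp⟩)).trans_eq (by rw [map_sub])

/-- A closed symmetric operator with a finite deficiency index has `dom T²` as a dense core. -/
theorem IsSymmetric.dense_and_isCore {T : H →ₗ.[ℂ] H} (hT : IsSymmetric T) (hc : T.IsClosed)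
    (hfin : HasFiniteDeficiencyIndex T) :
    Dense ((opSq T).domain : Set H) ∧ IsCore T (opSq T).domain := by
  have h : T.graph ≤ (T.domRestrict (opSq T).domain).graph.topologicalClosure := by
    rcases hfin with h | h
    · exact hT.graph_le_closure_of_finiteDimensional hc (by simp) (by simp) h
    · exact hT.graph_le_closure_of_finiteDimensional hc (by simp) (by simp) h
  constructor
  · refine dense_closure.1 (hT.dense.mono fun f hf => ?_)
    have h1 := h (T.mem_graph ⟨f, hf⟩)
    rw [← SetLike.mem_coe, Submodule.topologicalClosure_coe] at h1
    refine closure_mono ?_ (image_closure_subset_closure_image continuous_fst ⟨_, h1, rfl⟩)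
    rintro _ ⟨⟨a, b⟩, hab, rfl⟩
    exact (mem_graph_domRestrict.1 hab).1
  · refine ⟨opSq_domain_le T, le_antisymm
      (hc.isClosable.closure_mono LinearPMap.domRestrict_le) (LinearPMap.le_of_le_graph ?_)⟩
    rwa [closure_eq_of_isClosed hc,
      ← (hT.isClosable_domRestrict _).graph_closure_eq_closure_graph]

end FiniteDeficiency

/-! ### A closed symmetric operator for which `dom S²` is not a core -/

section BlockOperator

variable {E F : Type*} [NormedAddCommGroup E] [InnerProductSpace ℂ E] [NormedAddCommGroup F]
  [InnerProductSpace ℂ F]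

/-- The graph `{((K u, K k, C k), (k, u, 0))}` of the block operator determined by `K` and `C`. -/
def blockGraph (K : E →L[ℂ] E) (C : E →L[ℂ] F) :
    Submodule ℂ (WithLp 2 (E × WithLp 2 (E × F)) × WithLp 2 (E × WithLp 2 (E × F))) where
  carrier := {p | ∃ u k, p = (WithLp.toLp 2 (K u, WithLp.toLp 2 (K k, C k)),
    WithLp.toLp 2 (k, WithLp.toLp 2 (u, 0)))}
  zero_mem' := ⟨0, 0, by simp only [map_zero]; rfl⟩
  add_mem' := by
    rintro _ _ ⟨u, k, rfl⟩ ⟨u', k', rfl⟩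
    refine ⟨u + u', k + k', ?_⟩
    simp only [map_add, Prod.mk_add_mk, ← WithLp.toLp_add, add_zero]
  smul_mem' := by
    rintro c _ ⟨u, k, rfl⟩
    refine ⟨c • u, c • k, ?_⟩
    simp only [map_smul, Prod.smul_mk, ← WithLp.toLp_smul, smul_zero]

/-- The operator `(K u, K k, C k) ↦ (k, u, 0)` in `E ⊕ E ⊕ F`. -/
noncomputable def blockOperator (K : E →L[ℂ] E) (C : E →L[ℂ] F) :
    WithLp 2 (E × WithLp 2 (E × F)) →ₗ.[ℂ] WithLp 2 (E × WithLp 2 (E × F)) :=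
  (blockGraph K C).toLinearPMap

variable {K : E →L[ℂ] E} {C : E →L[ℂ] F}

theorem mem_graph_blockOperator_iff (hK : Function.Injective K)
    {p q : WithLp 2 (E × WithLp 2 (E × F))} :
    (p, q) ∈ (blockOperator K C).graph ↔ ∃ u k,
      p = WithLp.toLp 2 (K u, WithLp.toLp 2 (K k, C k)) ∧
        q = WithLp.toLp 2 (k, WithLp.toLp 2 (u, 0)) := by
  rw [blockOperator, Submodule.toLinearPMap_graph_eq]
  · simp only [blockGraph, Submodule.mem_mk, AddSubmonoid.mem_mk, AddSubsemigroup.mem_mk,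
      Set.mem_ofPred_eq, Prod.mk.injEq]
  · rintro ⟨p, q⟩ ⟨u, k, h⟩ (rfl : p = 0)
    obtain ⟨h1, h2⟩ := Prod.mk.inj h
    have hu : u = 0 := hK (by rw [map_zero]; exact (congrArg (fun x => x.fst) h1).symm)
    have hk : k = 0 := hK (by rw [map_zero]; exact (congrArg (fun x => x.snd.fst) h1).symm)
    rw [h2, hu, hk]
    rfl

theorem inner_blockOperator (hKs : ∀ x y, inner ℂ (K x) y = inner ℂ x (K y))
    (hK : Function.Injective K) (f g : (blockOperator K C).domain) :
    inner ℂ (blockOperator K C f) (g : WithLp 2 (E × WithLp 2 (E × F))) =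
      inner ℂ (f : WithLp 2 (E × WithLp 2 (E × F))) (blockOperator K C g) := by
  obtain ⟨u, k, h1, h2⟩ := (mem_graph_blockOperator_iff hK).1 ((blockOperator K C).mem_graph f)
  obtain ⟨u', k', h3, h4⟩ := (mem_graph_blockOperator_iff hK).1 ((blockOperator K C).mem_graph g)
  rw [h1, h2, h3, h4]
  simp [WithLp.prod_inner_apply, hKs, add_comm]

theorem isClosed_blockOperator (hK : Function.Injective K) : (blockOperator K C).IsClosed := by
  refine IsSeqClosed.isClosed fun x p hx hp => ?_
  choose u k h1 h2 using fun n =>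
    (mem_graph_blockOperator_iff (p := (x n).1) (q := (x n).2) hK).1 (hx n)
  have hx1 : Tendsto (fun n => (x n).1) atTop (𝓝 p.1) := (continuous_fst.tendsto p).comp hp
  have hx2 : Tendsto (fun n => (x n).2) atTop (𝓝 p.2) := (continuous_snd.tendsto p).comp hp
  have hk : Tendsto k atTop (𝓝 p.2.fst) :=
    (((WithLp.fstL 2 ℂ E (WithLp 2 (E × F))).continuous.tendsto _).comp hx2).congr
      fun n => congrArg WithLp.fst (h2 n)
  have hu : Tendsto u atTop (𝓝 p.2.snd.fst) :=
    ((((WithLp.fstL 2 ℂ E F).comp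
      (WithLp.sndL 2 ℂ E (WithLp 2 (E × F)))).continuous.tendsto _).comp hx2).congr
      fun n => congrArg (fun y => y.snd.fst) (h2 n)
  have hz : p.2.snd.snd = 0 := by
    refine tendsto_nhds_unique ((((WithLp.sndL 2 ℂ E F).comp
      (WithLp.sndL 2 ℂ E (WithLp 2 (E × F)))).continuous.tendsto _).comp hx2) ?_
    exact tendsto_const_nhds.congr fun n => (congrArg (fun y => y.snd.snd) (h2 n)).symm
  refine (mem_graph_blockOperator_iff hK).2 ⟨p.2.snd.fst, p.2.fst, ?_, ?_⟩
  · refine tendsto_nhds_unique hx1 ?_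
    simp only [h1]
    have hc : Continuous fun y : E × E =>
      WithLp.toLp 2 (K y.1, WithLp.toLp 2 (K y.2, C y.2)) := by fun_prop
    exact (hc.tendsto _).comp (hu.prodMk_nhds hk)
  · rw [← hz]
    rfl

/-- The domain of `S²` consists of the vectors `(K² k, K² u, C K u)` with `C k = 0`: the last
component `0` of `S f` has to be `C k`, and this is the only constraint on `k`. -/
theorem mem_opSq_blockOperator_domain_iff (hK : Function.Injective K)
    {p : WithLp 2 (E × WithLp 2 (E × F))} :
    p ∈ (opSq (blockOperator K C)).domain ↔ ∃ u k, C k = 0 ∧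
      p = WithLp.toLp 2 (K (K k), WithLp.toLp 2 (K (K u), C (K u))) := by
  rw [mem_opSq_domain_iff]
  constructor
  · rintro ⟨q, hq, hpq⟩
    obtain ⟨u, k, rfl, rfl⟩ := (mem_graph_blockOperator_iff hK).1 hpq
    obtain ⟨r, hr⟩ := LinearPMap.mem_domain_iff.1 hq
    obtain ⟨u', k', h, -⟩ := (mem_graph_blockOperator_iff hK).1 hr
    have e1 : k = K u' := congrArg (fun y => y.fst) h
    have e2 : u = K k' := congrArg (fun y => y.snd.fst) h
    have e3 : 0 = C k' := congrArg (fun y => y.snd.snd) h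
    exact ⟨u', k', e3.symm, by rw [e1, e2]⟩
  · rintro ⟨u, k, hk, rfl⟩
    refine ⟨_, ?_, (mem_graph_blockOperator_iff hK).2 ⟨K k, K u, rfl, rfl⟩⟩
    refine LinearPMap.mem_domain_iff.2 ⟨_, (mem_graph_blockOperator_iff hK).2 ⟨u, k, ?_, rfl⟩⟩
    rw [hk]

variable [CompleteSpace E] [CompleteSpace F]

/-- If `G` is injective with `ran G ∩ ran K = 0`, and the closure of `ran G` meets `ran K²`
trivially, then `dom S²` is dense, where `S` is the block operator of `K` and `C = G*`. -/
theorem dense_opSq_blockOperator {G : F →L[ℂ] E}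
    (hKs : ∀ x y, inner ℂ (K x) y = inner ℂ x (K y)) (hK : Function.Injective K)
    (hG : ∀ y z, K y = G z → z = 0)
    (hG2 : ∀ x, K (K x) ∈ (LinearMap.range G.toLinearMap).topologicalClosure → x = 0) :
    Dense ((opSq (blockOperator K (ContinuousLinearMap.adjoint G))).domain :
      Set (WithLp 2 (E × WithLp 2 (E × F)))) := by
  rw [Submodule.dense_iff_topologicalClosure_eq_top, Submodule.topologicalClosure_eq_top_iff,
    Submodule.eq_bot_iff]
  intro w hw
  have key : ∀ u k, ContinuousLinearMap.adjoint G k = 0 →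
      inner ℂ (K (K k)) w.fst + (inner ℂ (K (K u)) w.snd.fst +
        inner ℂ (ContinuousLinearMap.adjoint G (K u)) w.snd.snd) = 0 := fun u k hk =>
    hw _ ((mem_opSq_blockOperator_domain_iff hK).2 ⟨u, k, hk, rfl⟩)
  have h1 : w.fst = 0 := by
    apply hG2
    -- The closure of `ran G` is the orthogonal complement of `ker G*`.
    rw [← Submodule.orthogonal_orthogonal_eq_closure, ContinuousLinearMap.orthogonal_range]
    intro k hk
    have := key 0 k hk
    simpa [hKs] using this
  have h2 : K w.snd.fst + G w.snd.snd = 0 := by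
    set m := K w.snd.fst + G w.snd.snd with hm
    have h := key (K m) 0 (map_zero _)
    rw [map_zero, map_zero, inner_zero_left, zero_add, ContinuousLinearMap.adjoint_inner_left,
      hKs (K (K m)), ← inner_add_right, ← hm, hKs (K m), inner_self_eq_zero] at h
    exact hK (by rw [h, map_zero])
  have h3 : w.snd.snd = 0 := hG (-w.snd.fst) _ (by
    rw [map_neg]; exact neg_eq_of_add_eq_zero_right h2)
  have h4 : w.snd.fst = 0 := hK (by simpa [h3] using h2)
  calc w = WithLp.toLp 2 (w.fst, WithLp.toLp 2 (w.snd.fst, w.snd.snd)) := rfl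
    _ = 0 := by rw [h1, h3, h4]; rfl

/-- On `dom S²` the second component of `S` is in `K (ker G*)`, which is orthogonal to `x` when `K
x` is in the closure of `ran G`; but `S (K x, 0, 0) = (0, x, 0)`. -/
theorem not_isCore_blockOperator {G : F →L[ℂ] E}
    (hKs : ∀ x y, inner ℂ (K x) y = inner ℂ x (K y)) (hK : Function.Injective K)
    (hS : IsSymmetric (blockOperator K (ContinuousLinearMap.adjoint G)))
    {x : E} (hx : x ≠ 0) (hKx : K x ∈ (LinearMap.range G.toLinearMap).topologicalClosure) :
    ¬ IsCore (blockOperator K (ContinuousLinearMap.adjoint G))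
      (opSq (blockOperator K (ContinuousLinearMap.adjoint G))).domain := by
  set S := blockOperator K (ContinuousLinearMap.adjoint G) with hSdef
  rintro ⟨-, hcore⟩
  have hmem : (WithLp.toLp 2 (K x, WithLp.toLp 2 (K 0, ContinuousLinearMap.adjoint G 0)),
      WithLp.toLp 2 ((0 : E), WithLp.toLp 2 (x, (0 : F)))) ∈ S.closure.graph :=
    LinearPMap.le_graph_of_le S.le_closure
      ((mem_graph_blockOperator_iff hK).2 ⟨x, 0, rfl, rfl⟩)
  rw [← hcore, mem_graph_closure_iff_seq (hS.isClosable_domRestrict _)] at hmem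
  obtain ⟨u, -, hu⟩ := hmem
  have hlim := ((((WithLp.fstL 2 ℂ E F).comp
    (WithLp.sndL 2 ℂ E (WithLp 2 (E × F)))).continuous.tendsto _).comp hu).inner (𝕜 := ℂ)
      (tendsto_const_nhds (x := x))
  refine hx (inner_self_eq_zero (𝕜 := ℂ).1 (tendsto_nhds_unique hlim
    (tendsto_const_nhds.congr fun n => ?_)))
  obtain ⟨hn, hng⟩ := mem_graph_domRestrict.1 (LinearPMap.mem_graph _ (u n))
  obtain ⟨v, k, hk, hv⟩ := (mem_opSq_blockOperator_domain_iff hK).1 hn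
  obtain ⟨v', k', h1, h2⟩ := (mem_graph_blockOperator_iff hK).1 hng
  have hv' : v' = K k := hK (congrArg (fun y => y.fst) (h1.symm.trans hv))
  have h3 : inner ℂ (K k) x = 0 := by
    rw [hKs]
    rw [← Submodule.orthogonal_orthogonal_eq_closure, ContinuousLinearMap.orthogonal_range] at hKx
    exact hKx k hk
  simp only [Function.comp_apply]
  rw [h2, hv']
  exact h3.symm

end BlockOperator

/-! ### The sequence-space data of the example -/

section Sequences

/-- Square-summable complex families. -/
abbrev Ell2 (ι : Type*) : Type _ := lp (fun _ : ι => ℂ) 2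

theorem memℓp_two_iff {ι : Type*} {f : ι → ℂ} : Memℓp f 2 ↔ Summable fun i => ‖f i‖ ^ 2 := by
  rw [memℓp_gen_iff (by simp)]
  simp

/-- A linear map into `ℓ²` which is defined everywhere and given by continuous coordinates. It is
bounded by the closed graph theorem. -/
noncomputable def ell2Lift {ι X : Type*} [NormedAddCommGroup X] [NormedSpace ℂ X] [CompleteSpace X]
    (c : ι → X →L[ℂ] ℂ) (hc : ∀ x, Memℓp (fun i => c i x) 2) : X →L[ℂ] Ell2 ι :=
  ContinuousLinearMap.ofSeqClosedGraph
    (g := { toFun := fun x => ⟨fun i => c i x, hc x⟩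
            map_add' := fun x y => lp.ext (funext fun i => map_add (c i) x y)
            map_smul' := fun a x => lp.ext (funext fun i => map_smul (c i) a x) })
    fun _ x y hu hy => lp.ext <| funext fun i => tendsto_nhds_unique
      (((lp.evalCLM ℂ (fun _ : ι => ℂ) 2 i).continuous.tendsto y).comp hy)
      (((c i).continuous.tendsto x).comp hu)

/-- The diagonal operator on `ℓ²` with coefficients of absolute value at most `1`. -/
noncomputable def diag {ι : Type*} (a : ι → ℝ) (ha : ∀ i, |a i| ≤ 1) : Ell2 ι →L[ℂ] Ell2 ι :=
  ell2Lift (fun i => (a i : ℂ) • lp.evalCLM ℂ (fun _ : ι => ℂ) 2 i) fun x => by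
    refine (lp.memℓp x).mono' fun i => ?_
    change ‖(a i : ℂ) * x i‖ ≤ ‖x i‖
    rw [norm_mul, Complex.norm_real]
    exact mul_le_of_le_one_left (norm_nonneg _) (ha i)

theorem diag_apply {ι : Type*} (a : ι → ℝ) (ha : ∀ i, |a i| ≤ 1) (x : Ell2 ι) (i : ι) :
    diag a ha x i = a i * x i := rfl

theorem inner_diag {ι : Type*} (a : ι → ℝ) (ha : ∀ i, |a i| ≤ 1) (x y : Ell2 ι) :
    inner ℂ (diag a ha x) y = inner ℂ x (diag a ha y) := by
  rw [lp.inner_eq_tsum, lp.inner_eq_tsum]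
  refine tsum_congr fun i => ?_
  rw [diag_apply, diag_apply]
  simp
  ring

/-- A row of a square-summable family tends to zero, so it is not bounded below. -/
theorem eq_zero_of_norm_le_row {α : Type*} (x : Ell2 (α × ℕ)) (j : α) {c : ℂ}
    (h : ∀ i, ‖c‖ ≤ ‖x (j, i)‖) : c = 0 := by
  have hs := (memℓp_two_iff.1 (lp.memℓp x)).comp_injective (Prod.mk_right_injective j)
  have hle : ‖c‖ ^ 2 ≤ 0 := ge_of_tendsto' hs.tendsto_atTop_zero fun i =>
    pow_le_pow_left₀ (norm_nonneg c) (h i) 2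
  exact norm_eq_zero.1 (pow_eq_zero_iff two_ne_zero |>.1 (le_antisymm hle (sq_nonneg _)))

/-- The square-summable weights `1 / (i + 1)`. -/
noncomputable def wt (i : ℕ) : ℝ := 1 / ((i : ℝ) + 1)

theorem wt_pos (i : ℕ) : 0 < wt i := by unfold wt; positivity

theorem wt_ne_zero (i : ℕ) : (wt i : ℂ) ≠ 0 := Complex.ofReal_ne_zero.2 (wt_pos i).ne'

theorem wt_le_one (i : ℕ) : wt i ≤ 1 := by
  unfold wt
  rw [div_le_one (by positivity)]
  linarith [Nat.cast_nonneg (α := ℝ) i]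

theorem abs_wt_le_one (i : ℕ) : |wt i| ≤ 1 := by
  rw [abs_of_pos (wt_pos i)]; exact wt_le_one i

theorem wt_zero : wt 0 = 1 := by simp [wt]

theorem tendsto_wt : Tendsto wt atTop (𝓝 0) := tendsto_one_div_add_atTop_nhds_zero_nat

theorem summable_wt_sq : Summable fun i => wt i ^ 2 := by
  have h := (Real.summable_one_div_nat_pow.2 one_lt_two).comp_injective Nat.succ_injective
  refine h.congr fun i => ?_
  simp [wt]

/-- The weights as an element of `ℓ²`. -/
noncomputable def wtVec : Ell2 ℕ := ⟨fun i => (wt i : ℂ), memℓp_two_iff.2 <| by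
  simpa [Complex.norm_real] using summable_wt_sq⟩

/-- The diagonal operator `(x_{j i}) ↦ (x_{j i} / (i + 1))`, acting in the same way on all rows. -/
noncomputable def rowDiag : Ell2 (Option ℕ × ℕ) →L[ℂ] Ell2 (Option ℕ × ℕ) :=
  diag (fun p => wt p.2) fun p => abs_wt_le_one p.2

theorem rowDiag_apply (x : Ell2 (Option ℕ × ℕ)) (p : Option ℕ × ℕ) :
    rowDiag x p = wt p.2 * x p := rfl

theorem rowDiag_injective : Function.Injective rowDiag := by
  rw [injective_iff_map_eq_zero]
  refine fun x hx => lp.ext (funext fun p => ?_)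
  have h : (wt p.2 : ℂ) * x p = 0 := by rw [← rowDiag_apply, hx]; rfl
  exact (mul_eq_zero.1 h).resolve_left (wt_ne_zero _)

/-- The vector with the weights in row `none` and zeros in the other rows. -/
noncomputable def rowVec : Ell2 (Option ℕ × ℕ) :=
  ⟨fun p => p.1.elim (wt p.2 : ℂ) fun _ => 0, memℓp_two_iff.2 <| by
    refine ((Prod.mk_right_injective (none : Option ℕ)).summable_iff ?_).1 ?_
    · rintro ⟨j | j, i⟩ h
      · exact absurd ⟨i, rfl⟩ h
      · simp
    · simpa [Function.comp_def] using summable_wt_sq⟩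

/-- The map `z ↦ (z_j / (i + 1))_{j i}` into the rows `some j`; row `none` is zero. -/
noncomputable def spread : Ell2 ℕ →L[ℂ] Ell2 (Option ℕ × ℕ) :=
  ell2Lift (fun p => p.1.elim 0 fun j => (wt p.2 : ℂ) • lp.evalCLM ℂ (fun _ : ℕ => ℂ) 2 j)
    fun z => memℓp_two_iff.2 <| by
      have hinj : Function.Injective fun q : ℕ × ℕ => (some q.1, q.2) := by
        rintro ⟨a, b⟩ ⟨c, d⟩ h
        simpa using h
      refine (hinj.summable_iff ?_).1 ?_
      · rintro ⟨j | j, i⟩ h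
        · simp
        · exact absurd ⟨(j, i), rfl⟩ h
      · refine (Summable.mul_of_nonneg (memℓp_two_iff.1 (lp.memℓp z)) summable_wt_sq
          (fun _ => sq_nonneg _) fun _ => sq_nonneg _).congr fun q => ?_
        change _ = ‖(wt q.2 : ℂ) * z q.1‖ ^ 2
        rw [norm_mul, Complex.norm_real, mul_pow, Real.norm_eq_abs, sq_abs, mul_comm]

/-- The map `z ↦ (w, z) n + V (w² z)`, where `w` are the weights, `n` has row `none` equal to `w²`
and `V` is `spread`. -/
noncomputable def coupling : Ell2 ℕ →L[ℂ] Ell2 (Option ℕ × ℕ) :=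
  (innerSL ℂ wtVec).smulRight (rowDiag rowVec) +
    spread.comp ((diag wt abs_wt_le_one).comp (diag wt abs_wt_le_one))

theorem coupling_none (z : Ell2 ℕ) (i : ℕ) :
    coupling z (none, i) = inner ℂ wtVec z * (wt i * wt i) := by
  change inner ℂ wtVec z * (wt i * wt i) + 0 = _
  rw [add_zero]

theorem coupling_some (z : Ell2 ℕ) (j i : ℕ) :
    coupling z (some j, i) = wt i * (wt j * (wt j * z j)) := by
  change inner ℂ wtVec z * (wt i * 0) + wt i * (wt j * (wt j * z j)) = _
  rw [mul_zero, mul_zero, zero_add]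

/-- The range of `coupling` meets that of `rowDiag` trivially, because a row `w_i c` of a vector in
the range of `rowDiag` comes from a constant row. -/
theorem eq_zero_of_rowDiag_eq_coupling {y : Ell2 (Option ℕ × ℕ)} {z : Ell2 ℕ}
    (h : rowDiag y = coupling z) : z = 0 := by
  refine lp.ext (funext fun j => ?_)
  have h1 : (wt j : ℂ) * (wt j * z j) = 0 := by
    refine eq_zero_of_norm_le_row y (some j) fun i => le_of_eq (congrArg norm ?_)
    have h2 : rowDiag y (some j, i) = coupling z (some j, i) := by rw [h]
    rw [rowDiag_apply, coupling_some] at h2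
    exact (mul_left_cancel₀ (wt_ne_zero i) h2).symm
  exact (mul_eq_zero.1 ((mul_eq_zero.1 h1).resolve_left (wt_ne_zero j))).resolve_left (wt_ne_zero j)

/-- Row `none` of a limit of vectors `coupling z` is a multiple of `w²`, all other rows are
multiples of `w`; a vector of `ran rowDiag²` has such a row only if the row is zero. -/
theorem eq_zero_of_rowDiag_sq_mem_closure {x : Ell2 (Option ℕ × ℕ)}
    (hx : rowDiag (rowDiag x) ∈ (LinearMap.range coupling.toLinearMap).topologicalClosure) :
    x = 0 := by
  -- `e` is the common shape of the rows, normalised by `e (j, 0) = 1`.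
  let e : Option ℕ × ℕ → ℂ := fun p => p.1.elim ((wt p.2 : ℂ) * wt p.2) fun _ => (wt p.2 : ℂ)
  have hcont : ∀ p, Continuous fun y : Ell2 (Option ℕ × ℕ) => y p := fun p =>
    (lp.evalCLM ℂ (fun _ : Option ℕ × ℕ => ℂ) 2 p).continuous
  have hclosed : IsClosed {y : Ell2 (Option ℕ × ℕ) | ∀ p, y p = y (p.1, 0) * e p} := by
    simp only [Set.ofPred_forall]
    exact isClosed_iInter fun p => isClosed_eq (hcont p) ((hcont _).mul continuous_const)
  have hsub : (LinearMap.range coupling.toLinearMap : Set (Ell2 (Option ℕ × ℕ))) ⊆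
      {y | ∀ p, y p = y (p.1, 0) * e p} := by
    rintro _ ⟨z, rfl⟩ ⟨j | j, i⟩
    · change coupling z (none, i) = coupling z (none, 0) * (wt i * wt i)
      rw [coupling_none, coupling_none, wt_zero]
      simp
    · change coupling z (some j, i) = coupling z (some j, 0) * wt i
      rw [coupling_some, coupling_some, wt_zero]
      push_cast
      ring
  have key : ∀ p, rowDiag (rowDiag x) p = rowDiag (rowDiag x) (p.1, 0) * e p :=
    closure_minimal hsub hclosed hx
  simp only [rowDiag_apply, wt_zero, Complex.ofReal_one, one_mul] at key
  have h0 : ∀ j, x (j, 0) = 0 := by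
    refine fun j => eq_zero_of_norm_le_row x j fun i => ?_
    have h := key (j, i)
    rcases j with _ | j
    · change (wt i : ℂ) * (wt i * x (none, i)) = x (none, 0) * (wt i * wt i) at h
      refine le_of_eq (congrArg norm ?_)
      refine mul_left_cancel₀ (wt_ne_zero i) (mul_left_cancel₀ (wt_ne_zero i) ?_)
      rw [h]
      ring
    · change (wt i : ℂ) * (wt i * x (some j, i)) = x (some j, 0) * wt i at h
      have h' : x (some j, 0) = wt i * x (some j, i) := by
        refine mul_left_cancel₀ (wt_ne_zero i) ?_
        rw [h, mul_comm]
      rw [h', norm_mul, Complex.norm_real]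
      exact mul_le_of_le_one_left (norm_nonneg _) (abs_wt_le_one i)
  refine lp.ext (funext fun p => ?_)
  have h := key p
  rw [h0, zero_mul] at h
  exact (mul_eq_zero.1 ((mul_eq_zero.1 h).resolve_left (wt_ne_zero _))).resolve_left (wt_ne_zero _)

/-- With `δ_m` the `m`-th unit vector, `coupling (δ_m / w_m)` is `rowDiag rowVec + spread (w_m
δ_m)`, and the second term tends to zero. -/
theorem rowDiag_rowVec_mem_closure :
    rowDiag rowVec ∈ (LinearMap.range coupling.toLinearMap).topologicalClosure := by
  classical
  have hsingle : ∀ m : ℕ, coupling (lp.single 2 m ((wt m : ℂ)⁻¹)) =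
      rowDiag rowVec + spread (lp.single 2 m (wt m : ℂ)) := by
    intro m
    have h1 : inner ℂ wtVec (lp.single 2 m ((wt m : ℂ)⁻¹)) = (1 : ℂ) := by
      rw [lp.inner_single_right]
      change (wt m : ℂ)⁻¹ * starRingEnd ℂ (wt m : ℂ) = 1
      rw [Complex.conj_ofReal, inv_mul_cancel₀ (wt_ne_zero m)]
    have h2 : diag wt abs_wt_le_one (diag wt abs_wt_le_one (lp.single 2 m ((wt m : ℂ)⁻¹))) =
        lp.single 2 m (wt m : ℂ) := by
      refine lp.ext (funext fun i => ?_)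
      rw [diag_apply, diag_apply]
      rcases eq_or_ne i m with rfl | h
      · rw [lp.single_apply_self, lp.single_apply_self, mul_inv_cancel₀ (wt_ne_zero _), mul_one]
      · rw [lp.single_apply_ne _ _ _ h, lp.single_apply_ne _ _ _ h, mul_zero, mul_zero]
    change inner ℂ wtVec (lp.single 2 m ((wt m : ℂ)⁻¹)) • rowDiag rowVec +
      spread (diag wt abs_wt_le_one (diag wt abs_wt_le_one _)) = _
    rw [h1, h2, one_smul]
  rw [← SetLike.mem_coe, Submodule.topologicalClosure_coe, mem_closure_iff_seq_limit]
  refine ⟨fun m => coupling (lp.single 2 m ((wt m : ℂ)⁻¹)), fun m => ⟨_, rfl⟩, ?_⟩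
  simp only [hsingle]
  have h0 : Tendsto (fun m => (lp.single 2 m (wt m : ℂ) : Ell2 ℕ)) atTop (𝓝 0) := by
    rw [tendsto_zero_iff_norm_tendsto_zero]
    refine tendsto_wt.congr fun m => ?_
    rw [lp.norm_single (by norm_num), Complex.norm_real, Real.norm_of_nonneg (wt_pos m).le]
  have h1 := ((spread.continuous.tendsto 0).comp h0).const_add (rowDiag rowVec)
  rwa [map_zero, add_zero] at h1

theorem rowVec_ne_zero : rowVec ≠ 0 := by
  intro h
  have h1 : rowVec (none, 0) = 0 := by rw [h]; rfl
  exact wt_ne_zero 0 h1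

end Sequences

end FriedrichsSquare

open scoped LinearPMap in
open FriedrichsSquare in
theorem theorem3p1 :
    -- (i), the formula for the Friedrichs extension, and when it equals `S* S̄`
    (∀ (H : Type*) [NormedAddCommGroup H] [InnerProductSpace ℂ H] [CompleteSpace H]
      (S : H →ₗ.[ℂ] H) (hS : IsSymmetric S) (hd : Dense ((opSq S).domain : Set H)),
      friedrichsExtension (hS.isSymmetric_opSq hd) hS.isNonneg_opSq =
          opMul (S.domRestrict (opSq S).domain).closure† (S.domRestrict (opSq S).domain).closure ∧
        IsSelfAdjoint (friedrichsExtension (hS.isSymmetric_opSq hd) hS.isNonneg_opSq) ∧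
        IsNonneg (friedrichsExtension (hS.isSymmetric_opSq hd) hS.isNonneg_opSq) ∧
        opSq S ≤ friedrichsExtension (hS.isSymmetric_opSq hd) hS.isNonneg_opSq ∧
        opMul S† S.closure = opMul S.closure† S.closure ∧
        (friedrichsExtension (hS.isSymmetric_opSq hd) hS.isNonneg_opSq = opMul S† S.closure ↔
          IsCore S (opSq S).domain)) ∧
    -- (i), the two operators differ in general, even for closed `S`
    (∃ (H : Type) (_ : NormedAddCommGroup H) (_ : InnerProductSpace ℂ H) (_ : CompleteSpace H)
      (S : H →ₗ.[ℂ] H) (hS : IsSymmetric S) (hd : Dense ((opSq S).domain : Set H)),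
      S.IsClosed ∧ ¬ IsCore S (opSq S).domain ∧
        friedrichsExtension (hS.isSymmetric_opSq hd) hS.isNonneg_opSq ≠ opMul S† S.closure) ∧
    -- (ii)
    (∀ (H : Type*) [NormedAddCommGroup H] [InnerProductSpace ℂ H] [CompleteSpace H]
      (S : H →ₗ.[ℂ] H) (hS : IsSymmetric S) (hd : Dense ((opSq S).domain : Set H)),
      HasFiniteDeficiencyIndex S.closure →
        (∃ (hS' : IsSymmetric S.closure) (hd' : Dense ((opSq S.closure).domain : Set H)),
          friedrichsExtension (hS'.isSymmetric_opSq hd') hS'.isNonneg_opSq = opMul S† S.closure ∧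
            IsCore S.closure (opSq S.closure).domain) ∧
        (S.IsClosed →
          friedrichsExtension (hS.isSymmetric_opSq hd) hS.isNonneg_opSq = opMul S† S.closure ∧
            IsCore S (opSq S).domain)) := by
  refine ⟨fun H _ _ _ S hS hd => ?_, ?_, fun H _ _ _ S hS hd hfin => ?_⟩
  · have hF := friedrichsExtension_opSq hS hd
    have hRd : Dense ((S.domRestrict (opSq S).domain).closure.domain : Set H) :=
      (dense_domRestrict_opSq hd).mono (LinearPMap.le_closure _).1
    have hRc := (hS.isClosable_domRestrict (opSq S).domain).closure_isClosed
    refine ⟨hF, ?_, ?_, ?_, by rw [closure_adjoint hS.dense hS.isClosable],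
      friedrichsExtension_opSq_eq_iff hS hd⟩
    · rw [hF]; exact isSelfAdjoint_adjoint_mul_self hRd hRc
    · rw [hF]; exact isNonneg_adjoint_mul_self hRd
    · rw [hF]; exact opSq_le_adjoint_mul_self hS hd
  · have hd := dense_opSq_blockOperator (K := rowDiag) (G := coupling) (inner_diag _ _)
      rowDiag_injective (fun _ _ => eq_zero_of_rowDiag_eq_coupling)
      fun _ => eq_zero_of_rowDiag_sq_mem_closure
    have hS : IsSymmetric (blockOperator rowDiag (ContinuousLinearMap.adjoint coupling)) :=
      ⟨hd.mono (opSq_domain_le _), inner_blockOperator (inner_diag _ _) rowDiag_injective⟩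
    have hcore := not_isCore_blockOperator (inner_diag _ _) rowDiag_injective hS rowVec_ne_zero
      rowDiag_rowVec_mem_closure
    exact ⟨_, _, _, inferInstance, _, hS, hd, isClosed_blockOperator rowDiag_injective, hcore,
      fun h => hcore ((friedrichsExtension_opSq_eq_iff hS hd).1 h)⟩
  · obtain ⟨hd', hcore⟩ := hS.closure.dense_and_isCore hS.isClosable.closure_isClosed hfin
    refine ⟨⟨hS.closure, hd', ?_, hcore⟩, fun hc => ?_⟩
    · rw [(friedrichsExtension_opSq_eq_iff hS.closure hd').2 hcore,
        closure_adjoint hS.dense hS.isClosable,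
        closure_eq_of_isClosed hS.isClosable.closure_isClosed]
    · rw [closure_eq_of_isClosed hc] at hfin
      have hcore' := (hS.dense_and_isCore hc hfin).2
      exact ⟨(friedrichsExtension_opSq_eq_iff hS hd).2 hcore', hcore'⟩
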